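/- Let $\mathcal A$ be a finitely generated commutative cancellative monoid (written additively) which is combinatorially finite, i.e. every $\mathbf a\in\mathcal A\setminus\{0\}$ can be written in only finitely many ways as a sum of nonzero elements of $\mathcal A$, and whose associated group $G(\mathcal A)$ is torsion free. Let $\mathbf a_1,\dots,\mathbf a_r$ generate $\mathcal A$, let $\Bbbk$ be a field and let $I_{\mathcal A}\subseteq R=\Bbbk[X_1,\dots,X_r]$ be the kernel of the $\Bbbk$-algebra morphism $R\to\Bbbk[\mathcal A]$, $X_i\mapsto \mathbf t^{\mathbf a_i}$. The $\mathcal A$-degree of $X^{\mathbf u}$ is $\sum_j u_j\mathbf a_j$. Let $d_1,\dots,d_r$ be positive integers such that $\sum_j d_ju_j=\sum_j d_jv_j$ whenever $X^{\mathbf u}$ and $X^{\mathbf v}$ have the same $\mathcal A$-degree. For each $i\in\{1,\dots,r\}$ let $\prec_i$ be a degree reverse lexicographic term order relative to $\deg X_j=d_j$ with $X_i$ as lowest variable, that is, a term order represented by a real $r\times r$ matrix $M$ ($X^{\mathbf u}\prec_i X^{\mathbf v}$ if and only if $M\mathbf u$ is lexicographically smaller than $M\mathbf v$) whose first row is $(d_1,\dots,d_r)$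 and whose second row (if $r\ge 2$) is $-\mathbf e_i$, where $\mathbf e_i$ is the $i$-th unit vector. Let $\mathcal G_i$ be the reduced Gröbner basis of $I_{\mathcal A}$ with respect to $\prec_i$. A binomial $f=X^{\mathbf u}-X^{\mathbf v}\in I_{\mathcal A}$ with $\mathbf u\ne\mathbf v$ is called indispensable if every system of generators of $I_{\mathcal A}$ consisting of binomials (polynomials with exactly two terms) contains a nonzero scalar multiple of $f$. Then $f$ is indispensable if and only if, for every $i\in\{1,\dots,r\}$, $f\in\mathcal G_i$ or $-f\in\mathcal G_i$. The same equivalence holds if, in the definition of indispensable, systems of binomial generators are replaced by systems of $\mathcal A$-homogeneous generators. -/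

import Mathlib

/-- A commutative monoid is combinatorially finite if every nonzero element can be written in only
finitely many ways as a sum of nonzero elements (the summands being recorded as a multiset). -/
def CombinatoriallyFinite (A : Type*) [AddCommMonoid A] : Prop :=
  ∀ x : A, x ≠ 0 → {s : Multiset A | (0 : A) ∉ s ∧ s.sum = x}.Finite

/-- The semigroup ideal `I_A` attached to generators `a 0, …, a (r-1)`: the kernel of the `k`-algebra
morphism `k[X_0, …, X_{r-1}] → k[A]` that sends `X_i` to `t^(a i)`. -/
noncomputable def semigroupIdeal (k : Type*) [Field k] {A : Type*} [AddCommMonoid A] {r : ℕ}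
    (a : Fin r → A) : Ideal (MvPolynomial (Fin r) k) :=
  RingHom.ker (MvPolynomial.aeval (R := k)
    (fun i => (AddMonoidAlgebra.single (a i) (1 : k) : AddMonoidAlgebra k A)))

/-- A system of binomial generators of `I`: a generating set all of whose members have exactly
two terms. -/
def IsBinomialGenerators {k : Type*} [Field k] {r : ℕ} (I : Ideal (MvPolynomial (Fin r) k))
    (S : Set (MvPolynomial (Fin r) k)) : Prop :=
  (∀ g ∈ S, g.support.card = 2) ∧ Ideal.span S = I

/-- A system of `A`-homogeneous generators of `I`, where `X_i` has `A`-degree `a i`. -/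
def IsHomogeneousGenerators {k : Type*} [Field k] {A : Type*} [AddCommMonoid A] {r : ℕ}
    (a : Fin r → A) (I : Ideal (MvPolynomial (Fin r) k))
    (S : Set (MvPolynomial (Fin r) k)) : Prop :=
  (∀ g ∈ S, ∃ b : A, MvPolynomial.IsWeightedHomogeneous a g b) ∧ Ideal.span S = I

/-- `f` is indispensable in `I_A`: up to a nonzero scalar it belongs to every system of binomial
generators of `I_A`. (Applied to binomials `f` of `I_A`.) -/
def IsIndispensable {k : Type*} [Field k] {A : Type*} [AddCommMonoid A] {r : ℕ}
    (a : Fin r → A) (f : MvPolynomial (Fin r) k) : Prop :=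
  ∀ S : Set (MvPolynomial (Fin r) k), IsBinomialGenerators (semigroupIdeal k a) S →
    ∃ c : k, c ≠ 0 ∧ c • f ∈ S

/-- The graded form of indispensability: up to a nonzero scalar, `f` belongs to every system of
`A`-homogeneous generators of `I_A`. (Applied to binomials `f` of `I_A`.) -/
def IsGradedIndispensable {k : Type*} [Field k] {A : Type*} [AddCommMonoid A] {r : ℕ}
    (a : Fin r → A) (f : MvPolynomial (Fin r) k) : Prop :=
  ∀ S : Set (MvPolynomial (Fin r) k), IsHomogeneousGenerators a (semigroupIdeal k a) S →
    ∃ c : k, c ≠ 0 ∧ c • f ∈ S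

/-- `m` is a degree reverse lexicographic term order relative to the grading `deg X_j = d j`, with
`X_i` as lowest variable: `m` is represented by an `r × r` matrix with first row `d` and second row
`-e_i`, i.e. `X^u` precedes `X^v` iff `M u` precedes `M v` lexicographically.
(If `r = 1` there is no second row.) -/
def IsDegRevLex {r : ℕ} (d : Fin r → ℕ) (i : Fin r) (m : MonomialOrder (Fin r)) : Prop :=
  ∃ M : Matrix (Fin r) (Fin r) ℝ,
    (∀ p : Fin r, p.val = 0 → M p = fun j => (d j : ℝ)) ∧
    (∀ p : Fin r, p.val = 1 → M p = -Pi.single i (1 : ℝ)) ∧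
    ∀ u v : Fin r →₀ ℕ, m.toSyn u < m.toSyn v ↔
      toLex (M.mulVec fun j => (u j : ℝ)) < toLex (M.mulVec fun j => (v j : ℝ))

/-- `G` is a Gröbner basis of the ideal `I` for the term order `m`: a finite subset of `I` whose
leading terms generate the initial ideal of `I`. -/
def IsGroebnerBasis {k : Type*} [Field k] {r : ℕ} (m : MonomialOrder (Fin r))
    (I : Ideal (MvPolynomial (Fin r) k)) (G : Set (MvPolynomial (Fin r) k)) : Prop :=
  G.Finite ∧ G ⊆ (I : Set (MvPolynomial (Fin r) k)) ∧
    Ideal.span (m.leadingTerm '' G) =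
      Ideal.span (m.leadingTerm '' (I : Set (MvPolynomial (Fin r) k)))

/-- `G` is the reduced Gröbner basis of `I` for `m`: all its members are monic, and no monomial
occurring in a member is divisible by the leading monomial of another member. -/
def IsReducedGroebnerBasis {k : Type*} [Field k] {r : ℕ} (m : MonomialOrder (Fin r))
    (I : Ideal (MvPolynomial (Fin r) k)) (G : Set (MvPolynomial (Fin r) k)) : Prop :=
  IsGroebnerBasis m I G ∧ (∀ g ∈ G, m.Monic g) ∧
    ∀ g ∈ G, ∀ h ∈ G, h ≠ g → ∀ w ∈ g.support, ¬ m.degree h ≤ w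

open MvPolynomial

open scoped MonomialOrder

/-! ### Fibers of the degree map and the ideal `I_A`. -/

section SemigroupIdeal

variable {k : Type*} [Field k] {A : Type*} [AddCommMonoid A] {r : ℕ} {a : Fin r → A}

/-! A binomial whose two coprime terms exhaust their `A`-degree cannot be avoided by homogeneous
generators (`isGradedIndispensable_of_fiber`), so it is enough that membership in every `G i`, up to
sign, forces this fiber condition. The trailing term of a binomial in a reduced basis is standard,
hence smallest in its degree; when `X_i` is lowest, no monomial of that degree then has a larger
exponent at `i`. By cancellation, the leading term is coprime to all smaller monomials of its
degree. Using these facts for all `i` (`fiber_of_isDegRevLex`), every monomial of the degree divides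
one of the two terms, and positivity of `d` turns divisibility into equality.

Conversely, a reduced basis consists of binomials and generates `I_A`, so it contains a multiple of
an indispensable `f`, with scalar `±1` by monicity. Binomials of `I_A` are homogeneous, so the
graded notion implies the other and closes the circle. -/

theorem aeval_single_monomial (a : Fin r → A) (w : Fin r →₀ ℕ) (c : k) :
    aeval (R := k) (fun i => (AddMonoidAlgebra.single (a i) (1 : k) : AddMonoidAlgebra k A))
      (monomial w c) = AddMonoidAlgebra.single (Finsupp.weight a w) c := by
  rw [aeval_monomial, Finsupp.weight_eq_sum, Finsupp.prod_fintype _ _ (fun i => pow_zero _)]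
  simp only [AddMonoidAlgebra.single_pow, one_pow]
  have h : ∀ s : Finset (Fin r), ∏ i ∈ s, (AddMonoidAlgebra.single (w i • a i) (1 : k)) =
      AddMonoidAlgebra.single (∑ i ∈ s, w i • a i) (1 : k) := by
    intro s
    induction s using Finset.induction_on with
    | empty => simp [AddMonoidAlgebra.one_def]
    | insert j s hj ih =>
      rw [Finset.prod_insert hj, Finset.sum_insert hj, ih, AddMonoidAlgebra.single_mul_single,
        one_mul]
  rw [h, AddMonoidAlgebra.coe_algebraMap, Function.comp_apply,
    AddMonoidAlgebra.single_mul_single, zero_add]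
  simp

/-- The coefficients of an element of `I_A` over each fiber of the degree map sum to zero. -/
theorem sum_coeff_eq_zero_of_mem_semigroupIdeal [DecidableEq A] {p : MvPolynomial (Fin r) k}
    (hp : p ∈ semigroupIdeal k a) (b : A) :
    ∑ w ∈ p.support with Finsupp.weight a w = b, coeff w p = 0 := by
  rw [semigroupIdeal, RingHom.mem_ker, p.as_sum, map_sum] at hp
  simp only [aeval_single_monomial] at hp
  have h := congrArg (fun x : AddMonoidAlgebra k A => x.coeff b) hp
  simpa [Finsupp.single_apply, Finset.sum_filter, AddMonoidAlgebra.coeff_sum] using h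

theorem monomial_sub_monomial_mem_semigroupIdeal {p q : Fin r →₀ ℕ}
    (h : Finsupp.weight a p = Finsupp.weight a q) :
    (monomial p 1 - monomial q 1 : MvPolynomial (Fin r) k) ∈ semigroupIdeal k a := by
  rw [semigroupIdeal, RingHom.mem_ker, map_sub, aeval_single_monomial, aeval_single_monomial, h,
    sub_self]

/-- A nonzero coefficient alone in its fiber would contradict the zero sum over that fiber. -/
theorem exists_ne_mem_support_of_mem_semigroupIdeal {p : MvPolynomial (Fin r) k}
    (hp : p ∈ semigroupIdeal k a) {w : Fin r →₀ ℕ} (hw : w ∈ p.support) :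
    ∃ q ∈ p.support, q ≠ w ∧ Finsupp.weight a q = Finsupp.weight a w := by
  classical
  by_contra! h
  have hs := sum_coeff_eq_zero_of_mem_semigroupIdeal hp (Finsupp.weight a w)
  rw [Finset.sum_eq_single_of_mem w (by simpa using hw)] at hs
  · exact mem_support_iff.mp hw hs
  · intro q hq hqw
    rw [Finset.mem_filter] at hq
    exact absurd hq.2 (h q hq.1 hqw)

theorem support_monomial_sub_monomial {p q : Fin r →₀ ℕ} (h : p ≠ q) :
    (monomial p 1 - monomial q 1 : MvPolynomial (Fin r) k).support = {p, q} := by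
  classical
  ext w
  simp only [mem_support_iff, coeff_sub, coeff_monomial, Finset.mem_insert, Finset.mem_singleton]
  by_cases hp : p = w <;> by_cases hq : q = w <;> simp_all [eq_comm]

/-- Elements of `I_A` with two terms are homogeneous. -/
theorem exists_isWeightedHomogeneous_of_card_support_eq_two {p : MvPolynomial (Fin r) k}
    (hp : p ∈ semigroupIdeal k a) (h2 : p.support.card = 2) :
    ∃ b : A, IsWeightedHomogeneous a p b := by
  obtain ⟨x, y, hxy, hs⟩ := Finset.card_eq_two.mp h2
  obtain ⟨q, hq, hqx, hw⟩ := exists_ne_mem_support_of_mem_semigroupIdeal hp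
    (w := x) (by rw [hs]; simp)
  have hqy : q = y := by
    rw [hs] at hq
    simpa [hqx] using hq
  refine ⟨Finsupp.weight a x, fun w hw' => ?_⟩
  have hmem : w ∈ p.support := mem_support_iff.mpr hw'
  rw [hs, Finset.mem_insert, Finset.mem_singleton] at hmem
  rcases hmem with rfl | rfl
  · rfl
  · rw [← hqy, hw]

theorem IsBinomialGenerators.isHomogeneousGenerators {S : Set (MvPolynomial (Fin r) k)}
    (hS : IsBinomialGenerators (semigroupIdeal k a) S) :
    IsHomogeneousGenerators a (semigroupIdeal k a) S :=
  ⟨fun g hg => exists_isWeightedHomogeneous_of_card_support_eq_two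
    (hS.2 ▸ Ideal.subset_span hg) (hS.1 g hg), hS.2⟩

theorem IsGradedIndispensable.isIndispensable {f : MvPolynomial (Fin r) k}
    (h : IsGradedIndispensable a f) : IsIndispensable a f :=
  fun S hS => h S hS.isHomogeneousGenerators

/-- A binomial with coprime terms that are the only monomials of their degree belongs, up to a
scalar, to every system of homogeneous generators. -/
theorem isGradedIndispensable_of_fiber {u v : Fin r →₀ ℕ} (huv : u ≠ v)
    (hw : Finsupp.weight a u = Finsupp.weight a v)
    (hdisj : ∀ j, u j = 0 ∨ v j = 0)
    (hfib : ∀ w, Finsupp.weight a w = Finsupp.weight a u → w = u ∨ w = v) :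
    IsGradedIndispensable a (monomial u 1 - monomial v 1 : MvPolynomial (Fin r) k) := by
  classical
  intro S ⟨hhom, hspan⟩
  by_contra! hS
  -- The coefficient at `u` would vanish on the whole span of `S`, yet it is 1 on the binomial.
  have hmon : ∀ g ∈ S, ∀ t, coeff u (g * monomial t 1) = 0 := by
    intro g hg t
    by_contra hne
    rw [coeff_mul_monomial'] at hne
    have htu : t ≤ u := by by_contra h; simp [h] at hne
    rw [if_pos htu, mul_one] at hne
    have hgI : g ∈ semigroupIdeal k a := hspan ▸ Ideal.subset_span hg
    have hlift : ∀ q, Finsupp.weight a q = Finsupp.weight a (u - t) → q = u - t ∨ q + t = v := by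
      intro q hq
      rcases hfib (q + t) (by rw [map_add, hq, ← map_add, tsub_add_cancel_of_le htu]) with h | h
      · left; rw [← h, add_tsub_cancel_right]
      · exact Or.inr h
    obtain ⟨q, hqs, hqne, hqw⟩ := exists_ne_mem_support_of_mem_semigroupIdeal hgI
      (mem_support_iff.mpr hne)
    have hqv : q + t = v := (hlift q hqw).resolve_left hqne
    -- `t` divides both `u` and `v`, which are coprime.
    have ht : t = 0 := by
      ext j
      have h1 := htu j
      have h2 : q j + t j = v j := by rw [← hqv]; rfl
      have := hdisj j
      simp only [Finsupp.coe_zero, Pi.zero_apply]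
      omega
    subst ht
    rw [tsub_zero] at hne hlift hqw
    obtain ⟨b, hb⟩ := hhom g hg
    have hsupp : g.support ⊆ {u, v} := by
      intro w hwg
      have : Finsupp.weight a w = Finsupp.weight a u := by
        rw [hb (mem_support_iff.mp hwg), hb hne]
      simpa using hfib w this
    -- The two coefficients of `g` are opposite, so `g` is itself a multiple of the binomial.
    have hsum := sum_coeff_eq_zero_of_mem_semigroupIdeal hgI (Finsupp.weight a u)
    rw [Finset.sum_filter, Finset.sum_subset hsupp, Finset.sum_pair huv] at hsum
    · simp only [hw, if_true] at hsum
      refine hS (coeff u g) hne ?_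
      convert hg
      ext w
      simp only [coeff_smul, coeff_sub, coeff_monomial, smul_eq_mul]
      by_cases hu : u = w
      · subst hu; simp [huv.symm]
      · by_cases hv : v = w
        · subst hv
          simp only [hu, if_false, if_true]
          linear_combination -hsum
        · have : w ∉ g.support := fun h => by
            have := hsupp h
            simp only [Finset.mem_insert, Finset.mem_singleton] at this
            tauto
          simp [hu, hv, notMem_support_iff.mp this]
    · intro w _ hwg
      simp [notMem_support_iff.mp hwg]
  have hmul : ∀ g ∈ S, ∀ q, coeff u (q * g) = 0 := by
    intro g hg q
    induction q using MvPolynomial.induction_on' with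
    | monomial t c =>
      have hc : monomial t c = c • monomial t (1 : k) := by
        rw [smul_monomial, smul_eq_mul, mul_one]
      rw [mul_comm, hc, mul_smul_comm, coeff_smul, hmon g hg, smul_zero]
    | add p q hp hq => rw [add_mul, coeff_add, hp, hq, add_zero]
  have hzero : ∀ p ∈ Ideal.span S, ∀ q, coeff u (q * p) = 0 := by
    intro p hp
    induction hp using Submodule.span_induction with
    | mem g hg => exact hmul g hg
    | zero => simp
    | add p₁ p₂ _ _ h₁ h₂ => intro q; rw [mul_add, coeff_add, h₁, h₂, add_zero]
    | smul c p _ h => intro q; rw [smul_eq_mul, ← mul_assoc, h]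
  have := hzero _ (hspan ▸ monomial_sub_monomial_mem_semigroupIdeal hw) 1
  rw [one_mul] at this
  simp [coeff_monomial, huv.symm] at this

end SemigroupIdeal

/-! ### Reduced Gröbner bases of arbitrary ideals. -/

section Groebner

variable {k : Type*} [Field k] {r : ℕ} {m : MonomialOrder (Fin r)}
  {I : Ideal (MvPolynomial (Fin r) k)} {G : Set (MvPolynomial (Fin r) k)}

theorem IsReducedGroebnerBasis.exists_degree_le (hG : IsReducedGroebnerBasis m I G)
    {f : MvPolynomial (Fin r) k} (hf : f ∈ I) (hf0 : f ≠ 0) :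
    ∃ g ∈ G, m.degree g ≤ m.degree f := by
  -- Monicity gives a monomial ideal, where membership is divisibility.
  have himg : m.leadingTerm '' G = (fun s => monomial s (1 : k)) '' (m.degree '' G) := by
    rw [Set.image_image]
    refine Set.image_congr fun g hg => ?_
    rw [MonomialOrder.leadingTerm, hG.2.1 g hg]
  have hmem : m.leadingTerm f ∈ Ideal.span (m.leadingTerm '' G) := by
    rw [hG.1.2.2]
    exact Ideal.subset_span ⟨f, hf, rfl⟩
  rw [himg, mem_ideal_span_monomial_image] at hmem
  obtain ⟨_, ⟨g, hg, rfl⟩, hle⟩ := hmem (m.degree f) (by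
    rw [MonomialOrder.support_leadingTerm' hf0]
    simp)
  exact ⟨g, hg, hle⟩

/-- A reduced Gröbner basis generates the ideal. -/
theorem IsReducedGroebnerBasis.span_eq (hG : IsReducedGroebnerBasis m I G) :
    Ideal.span G = I := by
  refine le_antisymm (Ideal.span_le.mpr hG.1.2.1) fun f hf => ?_
  obtain ⟨g, p, hfg, -, hp⟩ := m.div_set (B := G)
    (fun b hb => by rw [(hG.2.1 b hb).leadingCoeff_eq_one]; exact isUnit_one) f
  have hlin : Finsupp.linearCombination _ (fun b : G => (b : MvPolynomial (Fin r) k)) g ∈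
      Ideal.span G := by
    rw [Finsupp.linearCombination_apply]
    exact Submodule.sum_mem _ fun b _ => Submodule.smul_mem _ _ (Ideal.subset_span b.2)
  have hpI : p ∈ I := by
    have : p = f - Finsupp.linearCombination _ (fun b : G => (b : MvPolynomial (Fin r) k)) g := by
      rw [hfg]; ring
    rw [this]
    exact I.sub_mem hf (Ideal.span_le.mpr hG.1.2.1 hlin)
  have hp0 : p = 0 := by
    by_contra h0
    obtain ⟨b, hb, hle⟩ := hG.exists_degree_le hpI h0
    exact hp _ (m.degree_mem_support h0) b hb hle
  rw [hfg, hp0, add_zero]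
  exact hlin

theorem IsReducedGroebnerBasis.not_degree_le_of_ne (hG : IsReducedGroebnerBasis m I G)
    {g : MvPolynomial (Fin r) k} (hg : g ∈ G) {w : Fin r →₀ ℕ} (hw : w ∈ g.support)
    (hne : w ≠ m.degree g) {h : MvPolynomial (Fin r) k} (hh : h ∈ G) : ¬ m.degree h ≤ w := by
  by_cases heq : h = g
  · subst heq
    intro hle
    exact hne (m.toSyn.injective (le_antisymm (m.le_degree hw) (m.toSyn_monotone hle)))
  · exact hG.2.2 g hg h hh heq w hw

/-- Leading monomials of a reduced Gröbner basis are minimal generators of the initial ideal. -/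
theorem IsReducedGroebnerBasis.not_degree_le_of_lt (hG : IsReducedGroebnerBasis m I G)
    {g : MvPolynomial (Fin r) k} (hg : g ∈ G) {w : Fin r →₀ ℕ} (hw : w < m.degree g)
    {h : MvPolynomial (Fin r) k} (hh : h ∈ G) : ¬ m.degree h ≤ w := by
  intro hle
  have hne : h ≠ g := by
    rintro rfl
    exact absurd hle hw.not_ge
  exact hG.2.2 g hg h hh hne _ (m.degree_mem_support (hG.2.1 g hg).ne_zero) (hle.trans hw.le)

theorem degree_monomial_sub_monomial {p q : Fin r →₀ ℕ} (h : q ≺[m] p) :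
    m.degree (monomial p 1 - monomial q 1 : MvPolynomial (Fin r) k) = p := by
  classical
  have hd : ∀ w, m.degree (monomial w 1 : MvPolynomial (Fin r) k) = w := fun w => by
    rw [m.degree_monomial, if_neg one_ne_zero]
  rw [m.degree_sub_of_lt (by rwa [hd, hd]), hd]

end Groebner

/-! ### Reduced Gröbner bases of `I_A`. -/

section GroebnerSemigroup

variable {k : Type*} [Field k] {A : Type*} [AddCommMonoid A] {r : ℕ} {a : Fin r → A}
  {m : MonomialOrder (Fin r)} {G : Set (MvPolynomial (Fin r) k)}

theorem IsReducedGroebnerBasis.exists_degree_le_of_lt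
    (hG : IsReducedGroebnerBasis m (semigroupIdeal k a) G) {p q : Fin r →₀ ℕ}
    (hw : Finsupp.weight a p = Finsupp.weight a q) (hlt : q ≺[m] p) :
    ∃ g ∈ G, m.degree g ≤ p := by
  have hdeg := degree_monomial_sub_monomial (k := k) hlt
  have h0 : (monomial p 1 - monomial q 1 : MvPolynomial (Fin r) k) ≠ 0 := by
    rw [← support_nonempty, support_monomial_sub_monomial (by rintro rfl; exact hlt.false)]
    simp
  simpa only [hdeg] using
    hG.exists_degree_le (monomial_sub_monomial_mem_semigroupIdeal hw) h0

/-- A standard monomial is the smallest monomial of its degree. -/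
theorem IsReducedGroebnerBasis.le_of_standard
    (hG : IsReducedGroebnerBasis m (semigroupIdeal k a) G) {w q : Fin r →₀ ℕ}
    (hstd : ∀ g ∈ G, ¬ m.degree g ≤ w) (hw : Finsupp.weight a w = Finsupp.weight a q) :
    w ≼[m] q := by
  by_contra! hlt
  obtain ⟨g, hg, hle⟩ := hG.exists_degree_le_of_lt hw hlt
  exact hstd g hg hle

/-- Each trailing monomial is standard, so there is at most one per degree. As no monomial of the
support is alone in its degree, all lie in the leading degree. -/
theorem IsReducedGroebnerBasis.card_support_eq_two
    (hG : IsReducedGroebnerBasis m (semigroupIdeal k a) G) {g : MvPolynomial (Fin r) k}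
    (hg : g ∈ G) : g.support.card = 2 := by
  have hgI := hG.1.2.1 hg
  have huniq : ∀ w ∈ g.support, ∀ q ∈ g.support, w ≠ m.degree g → q ≠ m.degree g →
      Finsupp.weight a w = Finsupp.weight a q → w = q := fun w hw q hq hwd hqd h =>
    m.toSyn.injective (le_antisymm
      (hG.le_of_standard (fun _ hh => hG.not_degree_le_of_ne hg hw hwd hh) h)
      (hG.le_of_standard (fun _ hh => hG.not_degree_le_of_ne hg hq hqd hh) h.symm))
  have hweight : ∀ w ∈ g.support, Finsupp.weight a w = Finsupp.weight a (m.degree g) := by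
    intro w hw
    by_cases hwd : w = m.degree g
    · rw [hwd]
    · obtain ⟨q, hq, hqw, hqa⟩ := exists_ne_mem_support_of_mem_semigroupIdeal hgI hw
      by_cases hqd : q = m.degree g
      · rw [← hqa, hqd]
      · exact absurd (huniq q hq w hw hqd hwd hqa) hqw
  have hlead := m.degree_mem_support (hG.2.1 g hg).ne_zero
  obtain ⟨q, hq, hqd, -⟩ := exists_ne_mem_support_of_mem_semigroupIdeal hgI hlead
  rw [Finset.card_eq_two]
  refine ⟨m.degree g, q, hqd.symm, ?_⟩
  ext w
  rw [Finset.mem_insert, Finset.mem_singleton]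
  constructor
  · intro hw
    by_contra! h
    exact h.2 (huniq w hw q hq h.1 hqd ((hweight w hw).trans (hweight q hq).symm))
  · rintro (rfl | rfl) <;> assumption

theorem IsReducedGroebnerBasis.isBinomialGenerators
    (hG : IsReducedGroebnerBasis m (semigroupIdeal k a) G) :
    IsBinomialGenerators (semigroupIdeal k a) G :=
  ⟨fun _ hg => hG.card_support_eq_two hg, hG.span_eq⟩

theorem IsIndispensable.mem_or_neg_mem {u v : Fin r →₀ ℕ} (huv : u ≠ v)
    (hf : IsIndispensable a (monomial u 1 - monomial v 1 : MvPolynomial (Fin r) k))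
    (hG : IsReducedGroebnerBasis m (semigroupIdeal k a) G) :
    (monomial u 1 - monomial v 1 : MvPolynomial (Fin r) k) ∈ G ∨
      -(monomial u 1 - monomial v 1 : MvPolynomial (Fin r) k) ∈ G := by
  classical
  obtain ⟨c, hc, hmem⟩ := hf G hG.isBinomialGenerators
  have hmon := (hG.2.1 _ hmem).coeff_degree
  have hdeg := m.degree_mem_support (hG.2.1 _ hmem).ne_zero
  rw [support_smul_eq hc, support_monomial_sub_monomial huv, Finset.mem_insert,
    Finset.mem_singleton] at hdeg
  rcases hdeg with h | h <;> rw [h] at hmon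
  · left
    have : c = 1 := by simpa [coeff_monomial, huv.symm] using hmon
    simpa [this] using hmem
  · right
    have : c = -1 := by
      have : -c = 1 := by simpa [coeff_monomial, huv] using hmon
      rw [← this, neg_neg]
    simpa [this] using hmem

end GroebnerSemigroup

/-- Among monomials of the same degree, a degree reverse lexicographic order prefers a smaller
exponent of the lowest variable. -/
theorem IsDegRevLex.lt_of_apply_lt {r : ℕ} {d : Fin r → ℕ} {i : Fin r} {m : MonomialOrder (Fin r)}
    (hm : IsDegRevLex d i m) (hr : 1 < r) {p q : Fin r →₀ ℕ}
    (hd : Finsupp.weight d p = Finsupp.weight d q) (hi : q i < p i) : p ≺[m] q := by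
  obtain ⟨M, h0, h1, hM⟩ := hm
  rw [hM]
  have hsum : ∀ w : Fin r →₀ ℕ, ∑ j, (d j : ℝ) * (w j : ℝ) = (Finsupp.weight d w : ℕ) := by
    intro w
    rw [Finsupp.weight_eq_sum]
    push_cast [smul_eq_mul]
    exact Finset.sum_congr rfl fun j _ => mul_comm _ _
  -- Row 0 ties by `hd`; row 1, which is `-e_i`, decides.
  refine ⟨⟨1, hr⟩, fun j hj => ?_, ?_⟩
  · have hj0 : j.val = 0 := by
      have : j.val < 1 := hj
      omega
    simp only [Matrix.mulVec, dotProduct, h0 j hj0, Pi.toLex_apply]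
    rw [hsum, hsum, hd]
  · simp only [Matrix.mulVec, Pi.toLex_apply, h1 ⟨1, hr⟩ rfl, neg_dotProduct, single_dotProduct,
      one_mul, neg_lt_neg_iff, Nat.cast_lt]
    exact hi

/-! ### Consequences of cancellation. -/

section Cancel

variable {k : Type*} [Field k] {A : Type*} [AddCancelCommMonoid A] {r : ℕ} {a : Fin r → A}
  {m : MonomialOrder (Fin r)} {G : Set (MvPolynomial (Fin r) k)}

/-- The leading monomial of an element of the reduced Gröbner basis is coprime to every smaller
monomial of the same degree. -/
theorem IsReducedGroebnerBasis.apply_eq_zero_or_of_lt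
    (hG : IsReducedGroebnerBasis m (semigroupIdeal k a) G) {g : MvPolynomial (Fin r) k}
    (hg : g ∈ G) {w : Fin r →₀ ℕ} (hw : Finsupp.weight a w = Finsupp.weight a (m.degree g))
    (hlt : w ≺[m] m.degree g) (j : Fin r) : m.degree g j = 0 ∨ w j = 0 := by
  by_contra! h
  obtain ⟨hgj, hwj⟩ := h
  -- Cancelling a common `X_j` would put a proper divisor of the leading monomial in the initial
  -- ideal.
  have hg' := Finsupp.sub_add_single_one_cancel hgj
  have hw' := Finsupp.sub_add_single_one_cancel hwj
  set p := m.degree g - Finsupp.single j 1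
  set q := w - Finsupp.single j 1
  have hpq : Finsupp.weight a p = Finsupp.weight a q := by
    rw [← hg', ← hw', map_add, map_add] at hw
    exact (add_right_cancel hw).symm
  have hlt' : q ≺[m] p := by
    rw [← hg', ← hw', map_add, map_add] at hlt
    exact lt_of_add_lt_add_right hlt
  obtain ⟨h, hh, hle⟩ := hG.exists_degree_le_of_lt hpq hlt'
  refine hG.not_degree_le_of_lt hg (w := p) ?_ hh hle
  refine lt_of_le_of_ne tsub_le_self fun heq => ?_
  have := DFunLike.congr_fun hg' j
  rw [← heq] at this
  simp [p] at this

theorem IsReducedGroebnerBasis.fiber_of_isDegRevLex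
    (hG : IsReducedGroebnerBasis m (semigroupIdeal k a) G) {d : Fin r → ℕ} {i : Fin r}
    (hm : IsDegRevLex d i m) (hr : 1 < r)
    (hd : ∀ u v : Fin r →₀ ℕ,
      Finsupp.weight a u = Finsupp.weight a v → Finsupp.weight d u = Finsupp.weight d v)
    {g : MvPolynomial (Fin r) k} (hg : g ∈ G) {p q : Fin r →₀ ℕ} (hpq : p ≠ q)
    (hsupp : g.support = {p, q}) (hdeg : m.degree g = p)
    (hw : Finsupp.weight a p = Finsupp.weight a q) :
    (∀ j, p j = 0 ∨ q j = 0) ∧ ∀ w, Finsupp.weight a w = Finsupp.weight a p → 0 < w i →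
      w i ≤ q i ∧ ∀ j, p j = 0 ∨ w j = 0 := by
  have hqs : q ∈ g.support := by simp [hsupp]
  have hlt : q ≺[m] p := by
    rw [← hdeg]
    refine lt_of_le_of_ne (m.le_degree hqs) fun h => hpq ?_
    rw [← hdeg, m.toSyn.injective h]
  have hdisj : ∀ j, p j = 0 ∨ q j = 0 := by
    simpa only [hdeg] using hG.apply_eq_zero_or_of_lt hg (w := q) (by rw [hdeg, hw])
      (by rwa [hdeg])
  refine ⟨hdisj, fun w hwp hwi => ?_⟩
  have hqw : q ≼[m] w := hG.le_of_standard
    (fun _ hh => hG.not_degree_le_of_ne hg hqs (by rw [hdeg]; exact hpq.symm) hh)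
    (hw.symm.trans hwp.symm)
  have hle : w i ≤ q i := by
    by_contra! h
    exact absurd hqw (hm.lt_of_apply_lt hr (hd _ _ (hwp.trans hw)) h).not_ge
  refine ⟨hle, ?_⟩
  -- Since `q i ≥ w i > 0`, coprimality gives `p i = 0 < w i`, so `w` precedes the leading term `p`.
  have hpi : p i = 0 := (hdisj i).resolve_right (by omega)
  simpa only [hdeg] using hG.apply_eq_zero_or_of_lt hg (w := w) (by rw [hdeg, hwp])
    (by rw [hdeg]; exact hm.lt_of_apply_lt hr (hd _ _ hwp) (by omega))

end Cancel

/-! ### Positive weights and the main equivalence. -/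

theorem eq_of_le_of_weight_eq {σ : Type*} {d : σ → ℕ} (hd : ∀ j, 0 < d j) {p q : σ →₀ ℕ}
    (hle : p ≤ q) (h : Finsupp.weight d p = Finsupp.weight d q) : p = q := by
  have hsub : Finsupp.weight d (q - p) = 0 := by
    have := congrArg (Finsupp.weight d) (tsub_add_cancel_of_le hle)
    rw [map_add] at this
    omega
  rw [Finsupp.weight_apply, Finsupp.sum, Finset.sum_eq_zero_iff] at hsub
  refine le_antisymm hle fun j => ?_
  by_contra! hj
  have hne : (q - p) j ≠ 0 := by
    rw [Finsupp.tsub_apply]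
    omega
  have := hsub j (Finsupp.mem_support_iff.mpr hne)
  exact (mul_ne_zero hne (hd j).ne') this

/-- With at most one variable, divisibility is total. This ensures that the matrix has its row
`-e_i`. -/
theorem one_lt_of_weight_eq_of_ne {r : ℕ} {d : Fin r → ℕ} (hd : ∀ j, 0 < d j)
    {u v : Fin r →₀ ℕ} (huv : u ≠ v) (h : Finsupp.weight d u = Finsupp.weight d v) : 1 < r := by
  by_contra! hr
  have hsub : Subsingleton (Fin r) := Fin.subsingleton_iff_le_one.mpr hr
  have hle : u ≤ v ∨ v ≤ u := by
    by_contra! hcon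
    obtain ⟨i, hi⟩ := not_forall.mp hcon.1
    obtain ⟨j, hj⟩ := not_forall.mp hcon.2
    rw [hsub.elim j i] at hj
    exact hj (le_of_not_ge hi)
  rcases hle with hle | hle
  · exact huv (eq_of_le_of_weight_eq hd hle h)
  · exact huv (eq_of_le_of_weight_eq hd hle h.symm).symm

theorem theorem3p2 {k : Type*} [Field k] {A : Type*} [AddCancelCommMonoid A]
    (hfin : CombinatoriallyFinite A)
    (htf : IsAddTorsionFree (Algebra.GrothendieckAddGroup A))
    {r : ℕ} (a : Fin r → A) (hgen : AddSubmonoid.closure (Set.range a) = ⊤)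
    (d : Fin r → ℕ) (hd_pos : ∀ j, 0 < d j)
    (hd : ∀ u v : Fin r →₀ ℕ,
      Finsupp.weight a u = Finsupp.weight a v → Finsupp.weight d u = Finsupp.weight d v)
    (m : Fin r → MonomialOrder (Fin r)) (hm : ∀ i, IsDegRevLex d i (m i))
    (G : Fin r → Set (MvPolynomial (Fin r) k))
    (hG : ∀ i, IsReducedGroebnerBasis (m i) (semigroupIdeal k a) (G i))
    (u v : Fin r →₀ ℕ) (huv : u ≠ v) (f : MvPolynomial (Fin r) k)
    (hf : f = MvPolynomial.monomial u 1 - MvPolynomial.monomial v 1)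
    (hfI : f ∈ semigroupIdeal k a) :
    (IsIndispensable a f ↔ ∀ i, f ∈ G i ∨ -f ∈ G i) ∧
    (IsGradedIndispensable a f ↔ ∀ i, f ∈ G i ∨ -f ∈ G i) := by
  subst hf
  have hsupp := support_monomial_sub_monomial (k := k) huv
  have hw : Finsupp.weight a u = Finsupp.weight a v := by
    obtain ⟨q, hq, hqu, hqw⟩ := exists_ne_mem_support_of_mem_semigroupIdeal hfI
      (w := u) (by rw [hsupp]; simp)
    rw [hsupp, Finset.mem_insert, Finset.mem_singleton] at hq
    rw [← hqw, hq.resolve_left hqu]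
  have hr := one_lt_of_weight_eq_of_ne hd_pos huv (hd u v hw)
  have hgb : IsIndispensable a (monomial u 1 - monomial v 1 : MvPolynomial (Fin r) k) →
      ∀ i, _ ∈ G i ∨ - _ ∈ G i := fun h i => h.mem_or_neg_mem huv (hG i)
  suffices hgr : (∀ i, (monomial u 1 - monomial v 1 : MvPolynomial (Fin r) k) ∈ G i ∨
      -(monomial u 1 - monomial v 1 : MvPolynomial (Fin r) k) ∈ G i) →
      IsGradedIndispensable a (monomial u 1 - monomial v 1 : MvPolynomial (Fin r) k) from
    ⟨⟨hgb, fun h => (hgr h).isIndispensable⟩, ⟨fun h => hgb h.isIndispensable, hgr⟩⟩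
  intro hmem
  have key : ∀ i, (∀ j, u j = 0 ∨ v j = 0) ∧
      ∀ w, Finsupp.weight a w = Finsupp.weight a u → 0 < w i →
        (w i ≤ u i ∧ ∀ j, v j = 0 ∨ w j = 0) ∨ (w i ≤ v i ∧ ∀ j, u j = 0 ∨ w j = 0) := by
    intro i
    obtain ⟨g, hg, hgs⟩ : ∃ g ∈ G i, g.support = {u, v} := by
      rcases hmem i with h | h
      · exact ⟨_, h, hsupp⟩
      · exact ⟨_, h, by rw [support_neg, hsupp]⟩
    have hdeg := (m i).degree_mem_support ((hG i).2.1 g hg).ne_zero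
    rw [hgs, Finset.mem_insert, Finset.mem_singleton] at hdeg
    rcases hdeg with h | h
    · obtain ⟨h₁, h₂⟩ := (hG i).fiber_of_isDegRevLex (hm i) hr hd hg huv hgs h hw
      exact ⟨h₁, fun w hwu hwi => Or.inr (h₂ w hwu hwi)⟩
    · obtain ⟨h₁, h₂⟩ := (hG i).fiber_of_isDegRevLex (hm i) hr hd hg huv.symm
        (by rw [hgs, Finset.pair_comm]) h hw.symm
      exact ⟨fun j => (h₁ j).symm, fun w hwu hwi => Or.inl (h₂ w (hwu.trans hw) hwi)⟩
  refine isGradedIndispensable_of_fiber huv hw (key ⟨0, by omega⟩).1 fun w hwu => ?_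
  have hle : w ≤ u ∨ w ≤ v := by
    by_cases hw0 : w = 0
    · left
      rw [hw0]
      exact zero_le
    -- One index in the support of `w` yields a term coprime to `w`; at every index of that support,
    -- the bound must then come from the other term.
    obtain ⟨i, hi⟩ := Finsupp.ne_iff.mp hw0
    rw [Finsupp.coe_zero, Pi.zero_apply] at hi
    rcases (key i).2 w hwu (Nat.pos_of_ne_zero hi) with h | h
    · refine Or.inl fun j => ?_
      have h₁ := h.2 j
      have h₂ := (key j).2 w hwu
      omega
    · refine Or.inr fun j => ?_
      have h₁ := h.2 j
      have h₂ := (key j).2 w hwu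
      omega
  rcases hle with h | h
  · exact Or.inl (eq_of_le_of_weight_eq hd_pos h (hd _ _ hwu))
  · exact Or.inr (eq_of_le_of_weight_eq hd_pos h (hd _ _ (hwu.trans hw)))
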